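/- Call $(v;k_1,k_2,k_3,k_4;\lambda)$, where $v\ge 1$ and $k_1,k_2,k_3,k_4\ge 0$ are integers and $\lambda$ is an integer, a GS-parameter set (Goethals--Seidel parameter set) if $$\sum_{i=1}^4 k_i(k_i-1)=\lambda(v-1)\quad\text{and}\quad \sum_{i=1}^4 k_i=\lambda+v.$$ For every odd integer $v\ge 1$ there is at least one GS-parameter set $(v;k_1,k_2,k_3,k_4;\lambda)$ with $$\frac{v-1}{2}=k_1\ge k_2\ge k_3\ge k_4\ge 0,$$ and, if $v>1$, with $\lambda\ge 0$. -/

import Mathlib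

/-- `(v; k₁, k₂, k₃, k₄; l)` is a Goethals–Seidel parameter set, where `k₁, …, k₄` are `k 0, …, k 3`.
The numbers `v` and `kᵢ` (a group order and block sizes) are natural numbers. The index `l`
is an integer: for `v = 1` the first condition puts no restriction on it, and for `1 < v`
it forces `0 ≤ l`. -/
structure IsGSParameterSet (v : ℕ) (k : Fin 4 → ℕ) (l : ℤ) : Prop where
  sum_mul_pred : ∑ i, (k i : ℤ) * ((k i : ℤ) - 1) = l * ((v : ℤ) - 1)
  sum_eq : ∑ i, (k i : ℤ) = l + (v : ℤ)

/-! Put `xᵢ = v - 2kᵢ` and `λ = ∑ kᵢ - v`: the conditions reduce to `∑ xᵢ² = 4v`. The choice `x₁ =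
1` leaves `4v - 1 ≡ 3 (mod 8)` to be written as three odd squares. Dirichlet's theorem and
reciprocity give a positive ternary form of determinant one representing this number; Hermite
reduction turns such a form into a sum of three squares. -/

/-- Every residue class modulo `a` has a representative of absolute value at most `a / 2`. -/
theorem Int.exists_abs_two_mul_add_mul_le {a : ℤ} (ha : 0 < a) (b : ℤ) :
    ∃ k : ℤ, -a ≤ 2 * (b + k * a) ∧ 2 * (b + k * a) ≤ a := by
  have h₁ := Int.mul_ediv_add_emod (2 * b + a) (2 * a)
  have h₂ := Int.emod_nonneg (2 * b + a) (b := 2 * a) (by omega)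
  have h₃ := Int.emod_lt_of_pos (2 * b + a) (b := 2 * a) (by omega)
  exact ⟨-((2 * b + a) / (2 * a)), by linarith, by linarith⟩

/-- Every positive integral binary form `A y² + 2 B y z + C z²` of determinant `D` properly
represents a positive number `m` with `3 m² ≤ 4 D`. -/
theorem exists_reduced_binary_form (A B C : ℤ) (hA : 0 < A) (hD : 0 < A * C - B ^ 2) :
    ∃ p q u w : ℤ, p * w - q * u = 1 ∧
      0 < A * p ^ 2 + 2 * B * p * u + C * u ^ 2 ∧
      3 * (A * p ^ 2 + 2 * B * p * u + C * u ^ 2) ^ 2 ≤ 4 * (A * C - B ^ 2) := by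
  induction hn : A.toNat using Nat.strong_induction_on generalizing A B C with
  | _ n ih =>
    obtain ⟨k, hk₁, hk₂⟩ := Int.exists_abs_two_mul_add_mul_le hA B
    set B' := B + k * A with hB'
    set C' := A * k ^ 2 + 2 * B * k + C with hC'
    have hdet : A * C' - B' ^ 2 = A * C - B ^ 2 := by rw [hC', hB']; ring
    have hC'pos : 0 < C' := by
      by_contra h
      nlinarith [sq_nonneg B']
    by_cases hlt : C' < A
    · obtain ⟨p, q, u, w, h₁, h₂, h₃⟩ := ih C'.toNat (by omega) C' (-B') A hC'pos
        (by linarith [neg_sq B']) rfl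
      have e : A * (k * p - u) ^ 2 + 2 * B * (k * p - u) * p + C * p ^ 2 =
          C' * p ^ 2 + 2 * (-B') * p * u + A * u ^ 2 := by rw [hC', hB']; ring
      refine ⟨k * p - u, k * q - w, p, q, by linear_combination h₁, by rw [e]; exact h₂, ?_⟩
      rw [e]
      linarith [neg_sq B']
    · refine ⟨1, 0, 0, 1, by ring, by simpa using hA, ?_⟩
      -- Here `2|B'| ≤ A ≤ C'`, so `A² ≤ A C' = D + B'² ≤ D + A²/4`.
      have hB2 : 4 * B' ^ 2 ≤ A ^ 2 := by nlinarith
      nlinarith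

/-- A positive integral binary quadratic form of determinant one represents only sums of
two squares. -/
theorem binary_form_eq_sum_two_sq (A B C : ℤ) (hA : 0 < A) (hD : A * C - B ^ 2 = 1) (y z : ℤ) :
    ∃ Y Z : ℤ, A * y ^ 2 + 2 * B * y * z + C * z ^ 2 = Y ^ 2 + Z ^ 2 := by
  obtain ⟨p, q, u, w, h₁, h₂, h₃⟩ := exists_reduced_binary_form A B C hA (by omega)
  set m := A * p ^ 2 + 2 * B * p * u + C * u ^ 2 with hm
  have hm1 : m = 1 := by nlinarith
  set M := A * p * q + B * (p * w + q * u) + C * u * w with hM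
  refine ⟨(w * y - q * z) + M * (p * z - u * y), p * z - u * y, ?_⟩
  set N := A * q ^ 2 + 2 * B * q * w + C * w ^ 2 with hN
  have hN1 : N = 1 + M ^ 2 := by
    have : m * N - M ^ 2 = (A * C - B ^ 2) * (p * w - q * u) ^ 2 := by rw [hm, hN, hM]; ring
    rw [hm1, hD, h₁] at this
    linarith
  have e : m * (w * y - q * z) ^ 2 + 2 * M * (w * y - q * z) * (p * z - u * y) +
      N * (p * z - u * y) ^ 2 =
      (A * y ^ 2 + 2 * B * y * z + C * z ^ 2) * (p * w - q * u) ^ 2 := by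
    rw [hm, hN, hM]; ring
  rw [h₁, hm1, hN1] at e
  linear_combination -e

/-- If `b ≥ a`, then `ab - t² ≥ 3a²/4`, hence `27a³ ≤ 64`, impossible for `a ≥ 2`. This drives the
descent on the leading coefficient. -/
theorem lt_of_hermite_bound {a b t : ℤ} (ha : 2 ≤ a) (h : 3 * (a * b - t ^ 2) ^ 2 ≤ 4 * a)
    (ht : 4 * t ^ 2 ≤ a ^ 2) : b < a := by
  by_contra! hab
  have h₁ : 3 * a ^ 2 ≤ 4 * (a * b - t ^ 2) := by nlinarith
  have h₂ : (3 * a ^ 2) ^ 2 ≤ (4 * (a * b - t ^ 2)) ^ 2 := pow_le_pow_left₀ (by positivity) h₁ 2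
  have h₃ : 2 ^ 3 ≤ a ^ 3 := pow_le_pow_left₀ (by norm_num) ha 3
  have h₄ : a * 2 ^ 3 ≤ a * a ^ 3 := mul_le_mul_of_nonneg_left h₃ (by omega)
  linarith

/-- A positive integral ternary quadratic form of determinant one represents only sums of
three squares. -/
theorem ternary_form_eq_sum_three_sq (a b c r s t : ℤ) (ha : 0 < a) (hab : 0 < a * b - t ^ 2)
    (hdet : a * b * c + 2 * r * s * t - a * r ^ 2 - b * s ^ 2 - c * t ^ 2 = 1) (x y z : ℤ) :
    ∃ X Y Z : ℤ, a * x ^ 2 + b * y ^ 2 + c * z ^ 2 + 2 * r * y * z + 2 * s * x * z +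
      2 * t * x * y = X ^ 2 + Y ^ 2 + Z ^ 2 := by
  induction hn : a.toNat using Nat.strong_induction_on generalizing a b c r s t x y z with
  | _ n ih =>
    -- Completing the square, `a f = (ax + ty + sz)² + g(y, z)`, where `g` has determinant `a`.
    have hbin : (a * b - t ^ 2) * (a * c - s ^ 2) - (a * r - s * t) ^ 2 = a := by
      linear_combination a * hdet
    obtain ⟨p, q, u, w, h₁, h₂, h₃⟩ := exists_reduced_binary_form (a * b - t ^ 2) (a * r - s * t)
      (a * c - s ^ 2) hab (by omega)
    rw [hbin] at h₃
    by_cases ha1 : a = 1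
    · subst ha1
      obtain ⟨Y, Z, h⟩ := binary_form_eq_sum_two_sq _ _ _ hab hbin y z
      exact ⟨x + t * y + s * z, Y, Z, by linear_combination h⟩
    set A' := (a * b - t ^ 2) * p ^ 2 + 2 * (a * r - s * t) * p * u + (a * c - s ^ 2) * u ^ 2
      with hA'
    obtain ⟨k, hk₁, hk₂⟩ := Int.exists_abs_two_mul_add_mul_le ha (t * p + s * u)
    set T := t * p + s * u + k * a with hT
    set S := t * q + s * w with hS
    set b' := a * k ^ 2 + b * p ^ 2 + c * u ^ 2 + 2 * r * p * u + 2 * s * k * u + 2 * t * k * p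
      with hb'
    set c' := b * q ^ 2 + c * w ^ 2 + 2 * r * q * w with hc'
    set R := b * p * q + c * u * w + r * (p * w + q * u) + s * k * w + t * k * q with hR
    have hAb : a * b' - T ^ 2 = A' := by rw [hb', hT, hA']; ring
    have hdet' : a * b' * c' + 2 * R * S * T - a * R ^ 2 - b' * S ^ 2 - c' * T ^ 2 = 1 := by
      have : a * b' * c' + 2 * R * S * T - a * R ^ 2 - b' * S ^ 2 - c' * T ^ 2 =
          (a * b * c + 2 * r * s * t - a * r ^ 2 - b * s ^ 2 - c * t ^ 2) *
          (p * w - q * u) ^ 2 := by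
        rw [hb', hT, hR, hS, hc']; ring
      rw [this, hdet, h₁]; norm_num
    have hT2 : 4 * T ^ 2 ≤ a ^ 2 := by
      have := mul_nonneg (sub_nonneg.2 hk₂) (neg_le_iff_add_nonneg.1 hk₁)
      linear_combination this
    have hb'pos : 0 < b' := by
      refine pos_of_mul_pos_right (a := a) ?_ ha.le
      linarith [sq_nonneg T]
    have hlt : b' < a := lt_of_hermite_bound (by omega) (hAb ▸ h₃) hT2
    obtain ⟨X, Y, Z, h⟩ := ih b'.toNat (by omega) b' a c' S R T hb'pos (by linarith)
      (by linarith) (w * y - q * z) (x - k * (w * y - q * z)) (p * z - u * y) rfl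
    refine ⟨X, Y, Z, h ▸ ?_⟩
    obtain ⟨y', hy'⟩ : ∃ y', y' = w * y - q * z := ⟨_, rfl⟩
    obtain ⟨z', hz'⟩ : ∃ z', z' = p * z - u * y := ⟨_, rfl⟩
    have hy : y = p * y' + q * z' := by rw [hy', hz']; linear_combination -y * h₁
    have hz : z = u * y' + w * z' := by rw [hy', hz']; linear_combination -z * h₁
    rw [← hy', ← hz', hb', hT, hR, hS, hc', hy, hz]
    ring

/-- If `n ≡ 3 (mod 8)`, then some `d > 0` has `-d` a quadratic residue modulo `d n - 1 = 2 p`. -/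
theorem exists_two_mul_dvd_sq_add {n : ℕ} (hn : n % 8 = 3) :
    ∃ p d : ℕ, 0 < d ∧ 2 * p + 1 = d * n ∧ 0 < p ∧ ∃ t : ℤ, (2 * p : ℤ) ∣ t ^ 2 + d := by
  have hco : ((n - 1) / 2).Coprime (4 * n) := by
    have h2 : ((n - 1) / 2).Coprime 2 := Nat.coprime_two_right.2 (Nat.odd_iff.2 (by omega))
    refine Nat.Coprime.mul_right (h2.pow_right 2) ?_
    have e : n = (n - 1) / 2 * 2 + 1 := by omega
    conv_rhs => rw [e]
    simp
  -- Then `p ≡ 1 (mod 4)`, `d ≡ 1 (mod 8)` and `2p ≡ -1 (mod d)`, so `(-d/p) = (p/d) = (2p/d) =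
  -- (-1/d) = 1`.
  obtain ⟨p, hpn, hp, hpm⟩ := Nat.forall_exists_prime_gt_and_modEq n (by omega) hco
  obtain ⟨j, hj⟩ := (Nat.modEq_iff_dvd' (by omega)).1 hpm.symm
  have hpj : p = 4 * (n * j) + (n - 1) / 2 := by rw [← mul_assoc, ← hj]; omega
  have hp4 : p % 4 = 1 := by omega
  have hd : 2 * p + 1 = (8 * j + 1) * n := by
    have : (8 * j + 1) * n = 8 * (n * j) + n := by ring
    omega
  refine ⟨p, 8 * j + 1, by omega, hd, hp.pos, ?_⟩
  set d := 8 * j + 1 with hdj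
  have hd8 : d % 8 = 1 := by omega
  have hdo : Odd d := Nat.odd_iff.2 (by omega)
  have hpo : Odd p := Nat.odd_iff.2 (by omega)
  have hneg : jacobiSym (-1) d = 1 := by
    rw [jacobiSym.at_neg_one hdo, ZMod.χ₄_nat_one_mod_four (by omega)]
  have htwo : jacobiSym 2 d = 1 := by
    rw [jacobiSym.at_two hdo, ZMod.χ₈_nat_eq_if_mod_eight]
    simp [hd8]; omega
  have hpd : jacobiSym p d = 1 := by
    have h : jacobiSym (2 * p) d = jacobiSym (-1) d := by
      refine jacobiSym.mod_left' (Int.ModEq.symm (Int.modEq_iff_dvd.2 ⟨n, ?_⟩))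
      have : (2 * p + 1 : ℤ) = d * n := by exact_mod_cast hd
      linarith
    rwa [jacobiSym.mul_left, htwo, hneg, one_mul] at h
  have hdp : jacobiSym (-d) p = 1 := by
    rw [jacobiSym.neg _ hpo, ZMod.χ₄_nat_one_mod_four hp4, one_mul,
      ← jacobiSym.quadratic_reciprocity_one_mod_four hp4 hdo, hpd]
  have := Fact.mk hp
  obtain ⟨y, hy⟩ : ∃ y : ℤ, (p : ℤ) ∣ y ^ 2 + d := by
    obtain ⟨x, hx⟩ := ZMod.isSquare_of_jacobiSym_eq_one hdp
    obtain ⟨y, rfl⟩ := ZMod.intCast_surjective x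
    refine ⟨y, (ZMod.intCast_zmod_eq_zero_iff_dvd _ _).1 ?_⟩
    push_cast at hx ⊢
    linear_combination -hx
  have hcop : IsCoprime (2 : ℤ) p := by
    exact_mod_cast Nat.isCoprime_iff_coprime.2 (Nat.coprime_two_left.2 hpo)
  have hdo' : Odd (d : ℤ) := by exact_mod_cast hdo
  have hpo' : Odd (p : ℤ) := by exact_mod_cast hpo
  -- Adding the odd `p` if needed makes `y` odd, so that `y² + d` is even.
  rcases Int.even_or_odd y with h | h
  · refine ⟨y + p, hcop.mul_dvd (((h.add_odd hpo').pow.add_odd hdo').two_dvd) ?_⟩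
    have : (y + p) ^ 2 + (d : ℤ) = (y ^ 2 + d) + p * (2 * y + p) := by ring
    rw [this]
    exact dvd_add hy (dvd_mul_right _ _)
  · exact ⟨y, hcop.mul_dvd ((h.pow.add_odd hdo').two_dvd) hy⟩

/-- Every natural number congruent to `3` modulo `8` is a sum of three squares. -/
theorem exists_sum_three_sq_of_mod_eight_eq_three {n : ℕ} (hn : n % 8 = 3) :
    ∃ x y z : ℤ, x ^ 2 + y ^ 2 + z ^ 2 = n := by
  obtain ⟨p, d, hd, hpd, hp, t, a, ha⟩ := exists_two_mul_dvd_sq_add hn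
  have hpd' : (2 * p + 1 : ℤ) = d * n := by exact_mod_cast hpd
  have hd' : (0 : ℤ) < d := by exact_mod_cast hd
  have hp' : (0 : ℤ) < p := by exact_mod_cast hp
  have ha0 : 0 < a := by
    by_contra h
    nlinarith [sq_nonneg t]
  -- The determinant is `n(2pa - t²) - 2p = nd - 2p = 1`; the value at `(0, 0, 1)` is `n`.
  obtain ⟨X, Y, Z, h⟩ := ternary_form_eq_sum_three_sq a (2 * p) n 0 1 t ha0 (by nlinarith)
    (by linear_combination (-n : ℤ) * ha - hpd') 0 0 1
  exact ⟨X, Y, Z, by linarith⟩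

/-- A natural number congruent to `3` modulo `8` is a sum of three odd squares. -/
theorem exists_sum_three_odd_sq_of_mod_eight_eq_three {n : ℕ} (hn : n % 8 = 3) :
    ∃ x y z : ℕ, Odd x ∧ Odd y ∧ Odd z ∧ x ≤ y ∧ y ≤ z ∧ x ^ 2 + y ^ 2 + z ^ 2 = n := by
  obtain ⟨x, y, z, h⟩ := exists_sum_three_sq_of_mod_eight_eq_three hn
  have key : ∃ x y z : ℕ, x ≤ y ∧ y ≤ z ∧ x ^ 2 + y ^ 2 + z ^ 2 = n := by
    have h' : x.natAbs ^ 2 + y.natAbs ^ 2 + z.natAbs ^ 2 = n := by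
      zify; simpa using h
    generalize x.natAbs = x at h'
    generalize y.natAbs = y at h'
    generalize z.natAbs = z at h'
    rcases le_total x y with h₁ | h₁ <;> rcases le_total y z with h₂ | h₂ <;>
      rcases le_total x z with h₃ | h₃
    · exact ⟨x, y, z, h₁, h₂, h'⟩
    · exact ⟨x, y, z, h₁, h₂, h'⟩
    · exact ⟨x, z, y, h₃, h₂, by linarith⟩
    · exact ⟨z, x, y, h₃, h₁, by linarith⟩
    · exact ⟨y, x, z, h₁, h₃, by linarith⟩
    · exact ⟨y, z, x, h₂, h₃, by linarith⟩
    · exact ⟨z, y, x, h₂, h₁, by linarith⟩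
    · exact ⟨z, y, x, h₂, h₁, by linarith⟩
  obtain ⟨x, y, z, hxy, hyz, h⟩ := key
  have sq_mod (a : ℕ) : (a % 2 = 1 ∧ a ^ 2 % 8 = 1) ∨ a ^ 2 % 8 = 0 ∨ a ^ 2 % 8 = 4 := by
    have : a % 8 < 8 := Nat.mod_lt _ (by norm_num)
    rw [Nat.pow_mod]
    interval_cases ha : a % 8 <;> simp <;> omega
  refine ⟨x, y, z, ?_, ?_, ?_, hxy, hyz, h⟩ <;> rw [Nat.odd_iff] <;>
    rcases sq_mod x with hx | hx | hx <;> rcases sq_mod y with hy | hy | hy <;>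
    rcases sq_mod z with hz | hz | hz <;> omega

theorem proposition2 (v : ℕ) (hv : Odd v) :
    ∃ (k : Fin 4 → ℕ) (l : ℤ), IsGSParameterSet v k l ∧
      k 0 = (v - 1) / 2 ∧ k 0 ≥ k 1 ∧ k 1 ≥ k 2 ∧ k 2 ≥ k 3 ∧ (1 < v → 0 ≤ l) := by
  rw [Nat.odd_iff] at hv
  obtain ⟨x, y, z, hx, hy, hz, hxy, hyz, h⟩ :=
    exists_sum_three_odd_sq_of_mod_eight_eq_three (n := 4 * v - 1) (by omega)
  have h4 : x ^ 2 + y ^ 2 + z ^ 2 + 1 = 4 * v := by omega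
  -- Needed for `(v - z) / 2` to be a true half: `z > v` would give `(v + 1)² ≤ 4v - 3`.
  have hzv : z ≤ v := by
    by_contra! hlt
    have h₁ : 1 ≤ x := hx.pos
    have h₂ : 1 ≤ y := hy.pos
    zify at *
    nlinarith [sq_nonneg ((v : ℤ) - 1)]
  rw [Nat.odd_iff] at hx hy hz
  obtain ⟨a, ha⟩ : ∃ a, v = 1 + 2 * a := ⟨(v - 1) / 2, by omega⟩
  obtain ⟨b, hb⟩ : ∃ b, v = x + 2 * b := ⟨(v - x) / 2, by omega⟩
  obtain ⟨c, hc⟩ : ∃ c, v = y + 2 * c := ⟨(v - y) / 2, by omega⟩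
  obtain ⟨d, hd⟩ : ∃ d, v = z + 2 * d := ⟨(v - z) / 2, by omega⟩
  have hsum : (a : ℤ) * (a - 1) + b * (b - 1) + c * (c - 1) + d * (d - 1) =
      ((a : ℤ) + b + c + d - v) * (v - 1) := by
    zify at h4 ha hb hc hd
    have e₁ : (x : ℤ) = v - 2 * b := by linarith
    have e₂ : (y : ℤ) = v - 2 * c := by linarith
    have e₃ : (z : ℤ) = v - 2 * d := by linarith
    have e₄ : (1 : ℤ) = (v - 2 * a) ^ 2 := by
      rw [show (v : ℤ) - 2 * a = 1 by linarith]; norm_num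
    rw [e₁, e₂, e₃] at h4
    linarith
  have hnonneg (m : ℕ) : 0 ≤ (m : ℤ) * (m - 1) := by
    rcases m.eq_zero_or_pos with rfl | hm
    · simp
    · exact mul_nonneg (by positivity) (by omega)
  refine ⟨![a, b, c, d], (a : ℤ) + b + c + d - v, ⟨?_, ?_⟩, ?_, ?_, ?_, ?_, fun hv1 => ?_⟩
  · simpa [Fin.sum_univ_four] using hsum
  · simp [Fin.sum_univ_four]
  · simp; omega
  · simp; omega
  · simp; omega
  · simp; omega
  · refine nonneg_of_mul_nonneg_left (b := (v : ℤ) - 1) ?_ (by omega)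
    rw [← hsum]
    linarith [hnonneg a, hnonneg b, hnonneg c, hnonneg d]
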